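/- Let $a,b,c,x_0,x_1,x_2\in\mathbb Z$, let $P(X)=X^3-aX^2-bX-c$ be irreducible over $\mathbb Q$, and let $p$ be a prime dividing neither $c$ nor the discriminant of $P$. Let $(x_n)_{n\in\mathbb Z}$ be the two-sided sequence of rational numbers with these initial values satisfying $x_n=ax_{n-1}+bx_{n-2}+cx_{n-3}$ for all $n\in\mathbb Z$ (so $x_n\in\mathbb Z$ for $n\ge 0$). Let $\lambda_1,\lambda_2,\lambda_3$ be the roots of $P$ in an algebraic closure $\overline{\mathbb Q_p}$ of $\mathbb Q_p$, let $\mathcal O$ be the ring of integers of $\mathbb Q_p(\lambda_1,\lambda_2,\lambda_3)$, and for $k\ge 1$ let $N_{p^k}$ be the order of the subgroup generated by the classes of $\lambda_1,\lambda_2,\lambda_3$ in $(\mathcal O/p^k\mathcal O)^\times$. Put $q(X)=x_0X^2+(x_1-x_0a)X+(x_2-x_1a-x_0b)$ and $c_{\lambda_i}=q(\lambda_i)/P'(\lambda_i)$. Let $\mathcal Z$ be the set of twisted integral zeros, i.e. of all $n\in\mathbb Z$ such that $\sum_{i=1}^3\xi_i c_{\lambda_i}\lambda_i^n=0$ for some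 roots of unity $\xi_1,\xi_2,\xi_3\in\overline{\mathbb Q_p}$. Let $\nu_p$ be the $p$-adic valuation on $\mathbb Q$, with $\nu_p(0)=\infty$. Say that Conjecture 1.1 holds for $p$ (and the sequence $(x_n)$) if there is an integer $Q\ge 1$ such that for every $i\in\{0,\dots,Q-1\}$ at least one of the following holds: (C) there is $\kappa_i\in\mathbb Z_{\ge 0}$ such that $\nu_p(x_n)=\kappa_i$ for all but finitely many $n\in\mathbb Z$ with $n\equiv i\pmod Q$; (L) there are $a_i,\kappa_i\in\mathbb Z$ and $\mu_i\in\mathbb Z_{>0}$ with $\nu_p(a_i-i)\ge\nu_p(Q)$ such that $\nu_p(x_n)=\kappa_i+\mu_i\,\nu_p(n-a_i)$ for all but finitely many $n\in\mathbb Z$ with $n\equiv i\pmod Q$. **Theorem 1.2.** (1) Let $p=2$ and $N=N_{p^2}$. If there is $\ell\in\{0,1,\dots,N-1\}$ such that $p^2\mid x_\ell$, $x_{\ell+N}-x_\ell\not\equiv 0\pmod{p^3}$ and $$\ell-\frac{x_\ell}{p^2}\left(\frac{x_{\ell+N}-x_\ell}{p^2}\right)^{-1}N\not\equiv r\pmod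 p\quad\text{for all } r\in\mathcal Z,$$ then Conjecture 1.1 does not hold for $p$. (2) Let $p\ne 2$ and $N=N_p$. If there is $\ell\in\{0,1,\dots,N-1\}$ such that $p\mid x_\ell$, $x_{\ell+N}-x_\ell\not\equiv 0\pmod{p^2}$ and $$\ell-\frac{x_\ell}{p}\left(\frac{x_{\ell+N}-x_\ell}{p}\right)^{-1}N\not\equiv r\pmod p\quad\text{for all } r\in\mathcal Z,$$ then Conjecture 1.1 does not hold for $p$. Here the inverses are taken modulo $p$; since $x_{\ell+N}\equiv x_\ell$ modulo $p^2$ (in (1)), respectively modulo $p$ (in (2)), the quotients are integers. -/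

import Mathlib

open Polynomial

/-- The characteristic polynomial `X³ - a X² - b X - c`. -/
noncomputable def charCubic (a b c : ℤ) : ℤ[X] :=
  X ^ 3 - C a * X ^ 2 - C b * X - C c

/-- The terms `x₀, x₁, x₂, …` of the recurrence `xₙ = a xₙ₋₁ + b xₙ₋₂ + c xₙ₋₃`. -/
def recNat (a b c x₀ x₁ x₂ : ℤ) : ℕ → ℤ
  | 0 => x₀
  | 1 => x₁
  | 2 => x₂
  | n + 3 => a * recNat a b c x₀ x₁ x₂ (n + 2) + b * recNat a b c x₀ x₁ x₂ (n + 1)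
      + c * recNat a b c x₀ x₁ x₂ n

/-- The terms `x₂, x₁, x₀, x₋₁, x₋₂, …`, obtained by solving the recurrence backwards:
the value at `n` is `x₂₋ₙ`. -/
def recBack (a b c x₀ x₁ x₂ : ℤ) : ℕ → ℚ
  | 0 => x₂
  | 1 => x₁
  | 2 => x₀
  | n + 3 => (recBack a b c x₀ x₁ x₂ n - a * recBack a b c x₀ x₁ x₂ (n + 1)
      - b * recBack a b c x₀ x₁ x₂ (n + 2)) / c

/-- The two-sided sequence `(xₙ)`, `n ∈ ℤ`. Terms of negative index are rational numbers whose
denominators divide a power of `c`. -/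
def recInt (a b c x₀ x₁ x₂ : ℤ) : ℤ → ℚ
  | Int.ofNat n => recNat a b c x₀ x₁ x₂ n
  | Int.negSucc n => recBack a b c x₀ x₁ x₂ (n + 3)

/-- The two-sided sequence satisfies the recurrence at every integer. -/
theorem recInt_rec (a b c x₀ x₁ x₂ : ℤ) (hc : c ≠ 0) (n : ℤ) :
    recInt a b c x₀ x₁ x₂ n = a * recInt a b c x₀ x₁ x₂ (n - 1)
      + b * recInt a b c x₀ x₁ x₂ (n - 2) + c * recInt a b c x₀ x₁ x₂ (n - 3) := by
  have hc' : (c : ℚ) ≠ 0 := by exact_mod_cast hc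
  match n with
  | Int.ofNat 0 =>
    change (x₀ : ℚ) = a * recBack a b c x₀ x₁ x₂ 3 + b * recBack a b c x₀ x₁ x₂ 4
      + c * recBack a b c x₀ x₁ x₂ 5
    rw [recBack.eq_def a b c x₀ x₁ x₂ 5]
    simp only [recBack]
    field_simp
    ring
  | Int.ofNat 1 =>
    change (x₁ : ℚ) = a * (x₀ : ℚ) + b * recBack a b c x₀ x₁ x₂ 3
      + c * recBack a b c x₀ x₁ x₂ 4
    rw [recBack.eq_def a b c x₀ x₁ x₂ 4]
    simp only [recBack]
    field_simp
    ring
  | Int.ofNat 2 =>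
    change (x₂ : ℚ) = a * (x₁ : ℚ) + b * (x₀ : ℚ) + c * recBack a b c x₀ x₁ x₂ 3
    simp only [recBack]
    field_simp
    ring
  | Int.ofNat (m + 3) =>
    have h1 : (Int.ofNat (m + 3) - 1) = Int.ofNat (m + 2) := by simp; ring
    have h2 : (Int.ofNat (m + 3) - 2) = Int.ofNat (m + 1) := by simp; ring
    have h3 : (Int.ofNat (m + 3) - 3) = Int.ofNat m := by simp
    rw [h1, h2, h3]
    simp only [recInt, recNat]
    push_cast
    ring
  | Int.negSucc m =>
    have h1 : (Int.negSucc m - 1) = Int.negSucc (m + 1) := by lia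
    have h2 : (Int.negSucc m - 2) = Int.negSucc (m + 2) := by lia
    have h3 : (Int.negSucc m - 3) = Int.negSucc (m + 3) := by lia
    rw [h1, h2, h3]
    change recBack a b c x₀ x₁ x₂ (m + 3) = a * recBack a b c x₀ x₁ x₂ (m + 4)
      + b * recBack a b c x₀ x₁ x₂ (m + 5) + c * recBack a b c x₀ x₁ x₂ (m + 3 + 3)
    rw [recBack.eq_def a b c x₀ x₁ x₂ (m + 3 + 3)]
    field_simp
    ring

/-- The `p`-adic valuation of a rational number, with `ν_p(0) = ∞`. -/
noncomputable def nuP (p : ℕ) [Fact p.Prime] (y : ℚ) : WithTop ℤ :=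
  Padic.addValuation (y : ℚ_[p])

/-- The Marques–Lengyel type conjecture for the two-sided sequence `x` and the prime `p`:
on every residue class modulo a suitable `Q`, up to finitely many exceptions, the valuation
`ν_p(xₙ)` is constant or an affine function of some `ν_p(n - aᵢ)`. -/
def ValuationConjecture (p : ℕ) [Fact p.Prime] (x : ℤ → ℚ) : Prop :=
  ∃ Q : ℕ, 0 < Q ∧ ∀ i : ℕ, i < Q →
    (∃ κ : ℕ, {n : ℤ | n ≡ i [ZMOD Q] ∧ ¬ nuP p (x n) = ((κ : ℤ) : WithTop ℤ)}.Finite) ∨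
    (∃ (α κ : ℤ) (μ : ℕ), 0 < μ ∧ nuP p Q ≤ nuP p ((α - i : ℤ) : ℚ) ∧
      {n : ℤ | n ≡ i [ZMOD Q] ∧
        ¬ nuP p (x n) = (κ : WithTop ℤ) + μ • nuP p ((n - α : ℤ) : ℚ)}.Finite)

/-- The coefficient `c_λ = q(λ) / P'(λ)`, where
`q(X) = x₀ X² + (x₁ - x₀ a) X + (x₂ - x₁ a - x₀ b)`. -/
noncomputable def coeffAt {L : Type*} [Field L] (a b c x₀ x₁ x₂ : ℤ) (z : L) : L :=
  ((x₀ : L) * z ^ 2 + ((x₁ - x₀ * a : ℤ) : L) * z + ((x₂ - x₁ * a - x₀ * b : ℤ) : L)) /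
    aeval z (derivative (charCubic a b c))

/-- The set of twisted integral zeros: the integers `n` such that `∑ ξᵢ c_{λᵢ} λᵢⁿ = 0` for some
roots of unity `ξ₁, ξ₂, ξ₃`. It is used with `L` algebraically closed. -/
def twistedIntegralZeros {L : Type*} [Field L] (a b c x₀ x₁ x₂ : ℤ) (lam : Fin 3 → L) : Set ℤ :=
  {n : ℤ | ∃ ξ : Fin 3 → L, (∀ i, IsOfFinOrder (ξ i)) ∧
    ∑ i, ξ i * coeffAt a b c x₀ x₁ x₂ (lam i) * lam i ^ n = 0}

/-- The ring of integers of `ℚ_p(λ₁, λ₂, λ₃)`. -/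
noncomputable abbrev intRing (p : ℕ) [Fact p.Prime] (lam : Fin 3 → AlgebraicClosure ℚ_[p]) :
    Subalgebra ℤ_[p] (IntermediateField.adjoin ℚ_[p] (Set.range lam)) :=
  integralClosure ℤ_[p] (IntermediateField.adjoin ℚ_[p] (Set.range lam))

/-- The order of the subgroup generated by (the classes of) `λ₁, λ₂, λ₃` in `(𝒪 / m)ˣ`, where `𝒪`
is the ring of integers of `ℚ_p(λ₁, λ₂, λ₃)`. -/
noncomputable def periodN (p : ℕ) [Fact p.Prime] (lam : Fin 3 → AlgebraicClosure ℚ_[p])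
    (m : ℕ) : ℕ :=
  Nat.card (Subgroup.closure
    {u : (intRing p lam ⧸ Ideal.span {(m : intRing p lam)})ˣ |
      ∃ (i : Fin 3) (z : intRing p lam),
        ((z : IntermediateField.adjoin ℚ_[p] (Set.range lam)) : AlgebraicClosure ℚ_[p]) = lam i ∧
        (u : intRing p lam ⧸ Ideal.span {(m : intRing p lam)}) = Ideal.Quotient.mk _ z})

/-- The class modulo `p` of `ℓ - (x_ℓ / m) ((x_{ℓ+N} - x_ℓ) / m)⁻¹ N`. It is used when `m` divides
both `x_ℓ` and `x_{ℓ+N} - x_ℓ`, so that the integer divisions are exact, and the inverse is taken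
modulo `p`. -/
def henselApprox (p : ℕ) (x : ℕ → ℤ) (m N ℓ : ℕ) : ZMod p :=
  (ℓ : ZMod p) - ((x ℓ / (m : ℤ) : ℤ) : ZMod p) *
    (((x (ℓ + N) - x ℓ) / (m : ℤ) : ℤ) : ZMod p)⁻¹ * (N : ZMod p)

/-!
The proof rests on Binet's formula `x n = ∑ i, c i * lam i ^ n` in the algebraic closure of `ℚ_[p]`
with its norm. Since `p` divides neither `c` nor the discriminant, the roots have norm `1` and the
coefficients norm at most `1`; by the choice of `N`, the powers `lam i ^ N` are `1` modulo `p ^ k`.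
No `p`-adic analytic functions are needed:

* `(1 + w) ^ d = 1 + d * w` up to an error of valuation larger than `k + ν_p(d)`
  (`PadicAlgCl.norm_one_add_pow_sub_le`; this is where `k ≥ 2` is used for `p = 2`). Hence
  `m ↦ x (ℓ + N * m)` changes by `d * (x (ℓ + N) - x ℓ)` up to such an error when `m` grows by `d`,
  and since `x (ℓ + N) - x ℓ` has valuation exactly `k`, a Hensel-type lifting produces terms
  `x (ℓ + N * m)` divisible by arbitrarily high powers of `p`, with `m` arbitrarily large
  (`exists_large_pow_dvd`). The exponents involved are congruent to the given approximate zero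
  modulo `p` (`henselApprox_eq_of_dvd`).
* If the conjecture held, some residue class modulo `Q` would contain such exponents for every power
  of `p`. A constant valuation is then impossible, and an affine valuation forces the exponents
  `n` to converge `p`-adically to an integer `α` (`ValuationConjecture.exists_limit`).
* The powers `lam i ^ (n - α)` have an `N`-th power tending to `1`, so they approach the finite set
  of `N`-th roots of unity. As `x n` tends to `0`, some choice of roots of unity makes
  `∑ i, ξ i * c i * lam i ^ α` vanish exactly (`PadicAlgCl.exists_twisted_zero`).

Thus `α` is a twisted integral zero congruent to the approximate zero modulo `p`, contrary to the
hypothesis.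
-/

/-! ### The `p`-adic norm on the algebraic closure of `ℚ_[p]` -/

section Norm

variable {p : ℕ} [Fact p.Prime]

theorem PadicAlgCl.norm_intCast (z : ℤ) : ‖(z : PadicAlgCl p)‖ = ‖(z : ℚ_[p])‖ := by
  rw [← PadicAlgCl.norm_extends p (z : ℚ_[p])]
  simp

theorem PadicAlgCl.norm_natCast (n : ℕ) : ‖(n : PadicAlgCl p)‖ = ‖(n : ℚ_[p])‖ := by
  simpa using PadicAlgCl.norm_intCast (p := p) n

theorem PadicAlgCl.norm_intCast_le_pow_iff (z : ℤ) (n : ℕ) :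
    ‖(z : PadicAlgCl p)‖ ≤ (p : ℝ)⁻¹ ^ n ↔ (p : ℤ) ^ n ∣ z := by
  rw [PadicAlgCl.norm_intCast]
  have := Padic.norm_int_le_pow_iff_dvd (p := p) z n
  rw [zpow_neg, zpow_natCast, ← inv_pow] at this
  exact_mod_cast this

theorem PadicAlgCl.norm_intCast_le_one (z : ℤ) : ‖(z : PadicAlgCl p)‖ ≤ 1 := by
  rw [PadicAlgCl.norm_intCast]
  exact Padic.norm_int_le_one z

theorem PadicAlgCl.norm_natCast_le_one (n : ℕ) : ‖(n : PadicAlgCl p)‖ ≤ 1 := by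
  simpa using PadicAlgCl.norm_intCast_le_one (p := p) n

theorem PadicAlgCl.norm_natCast_prime : ‖(p : PadicAlgCl p)‖ = (p : ℝ)⁻¹ := by
  rw [PadicAlgCl.norm_natCast, Padic.norm_p]

theorem PadicAlgCl.norm_natCast_eq_pow {n : ℕ} (hn : n ≠ 0) :
    ‖(n : PadicAlgCl p)‖ = (p : ℝ)⁻¹ ^ padicValNat p n := by
  rw [PadicAlgCl.norm_natCast, Padic.norm_eq_zpow_neg_valuation (by exact_mod_cast hn),
    Padic.valuation_natCast, zpow_neg, zpow_natCast, inv_pow]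

theorem PadicAlgCl.norm_add_le_of_le {x y : PadicAlgCl p} {r : ℝ} (hx : ‖x‖ ≤ r) (hy : ‖y‖ ≤ r) :
    ‖x + y‖ ≤ r :=
  (PadicAlgCl.isNonarchimedean p x y).trans (max_le hx hy)

theorem PadicAlgCl.norm_le_one_of_isIntegral {x : PadicAlgCl p} (hx : IsIntegral ℤ_[p] x) :
    ‖x‖ ≤ 1 := by
  obtain ⟨f, hf, hfx⟩ := hx
  rw [← aeval_def, hf.as_sum] at hfx
  simp only [map_add, map_pow, aeval_X, map_sum, map_mul, aeval_C] at hfx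
  by_contra! h
  have hpos : 0 < ‖x‖ := one_pos.trans h
  have hlt : ‖∑ i ∈ Finset.range f.natDegree, algebraMap ℤ_[p] (PadicAlgCl p) (f.coeff i) * x ^ i‖
      ≤ ‖x‖ ^ f.natDegree / ‖x‖ := by
    refine IsUltrametricDist.norm_sum_le_of_forall_le_of_nonneg (by positivity) fun i hi => ?_
    have hi : i + 1 ≤ f.natDegree := Finset.mem_range.1 hi
    rw [le_div_iff₀ hpos, norm_mul, norm_pow, mul_assoc, ← pow_succ]
    have hc : ‖algebraMap ℤ_[p] (PadicAlgCl p) (f.coeff i)‖ ≤ 1 := by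
      rw [IsScalarTower.algebraMap_apply ℤ_[p] ℚ_[p] (PadicAlgCl p)]
      exact (PadicAlgCl.norm_extends p _).trans_le (PadicInt.norm_le_one _)
    calc _ ≤ 1 * ‖x‖ ^ (i + 1) := by gcongr
      _ ≤ ‖x‖ ^ f.natDegree := by
        rw [one_mul]; exact pow_le_pow_right₀ h.le hi
  rw [← norm_neg, ← eq_neg_of_add_eq_zero_left hfx, norm_pow, le_div_iff₀ hpos] at hlt
  nlinarith [pow_pos hpos f.natDegree]

/-- The valuation of a binomial summand: `j * (d choose j) = d * (d - 1 choose j - 1)`, and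
`w ^ j / j` is small because `ν_p(j) < k (j - 1)`. -/
theorem PadicAlgCl.norm_choose_mul_pow_le {k : ℕ} (hk : 1 ≤ k) (hk2 : p = 2 → 2 ≤ k)
    {w : PadicAlgCl p} (hw : ‖w‖ ≤ (p : ℝ)⁻¹ ^ k) (d : ℕ) {j : ℕ} (hj : 2 ≤ j) :
    ‖(d.choose j : PadicAlgCl p) * w ^ j‖ ≤ ‖(d : PadicAlgCl p)‖ * (p : ℝ)⁻¹ ^ (k + 1) := by
  have hp : p.Prime := Fact.out
  have hr0 : (0 : ℝ) ≤ (p : ℝ)⁻¹ := by positivity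
  have hr1 : (p : ℝ)⁻¹ ≤ 1 := inv_le_one_of_one_le₀ (by exact_mod_cast hp.one_le)
  obtain ⟨i, rfl⟩ : ∃ i, j = i + 2 := ⟨j - 2, by omega⟩
  have hpj : p ^ padicValNat p (i + 2) ≤ i + 2 :=
    Nat.le_of_dvd (by omega) pow_padicValNat_dvd
  set v := padicValNat p (i + 2) with hv
  have hexp : k + 1 + v ≤ k * (i + 2) := by
    have hbern (b : ℕ) : 1 + v * b ≤ (1 + b) ^ v := by
      exact_mod_cast one_add_mul_le_pow (a := (b : ℤ)) (by omega) v
    rcases Nat.lt_or_ge k 2 with h | h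
    · have h3 : 3 ≤ p := by
        have := hp.two_le
        by_contra hlt
        have := hk2 (by omega)
        omega
      obtain rfl : k = 1 := by omega
      have h1 : (1 + 2) ^ v ≤ p ^ v := Nat.pow_le_pow_left h3 v
      have := hbern 2
      rcases Nat.eq_zero_or_pos v with h0 | h0 <;> omega
    · have h1 : (1 + 1) ^ v ≤ p ^ v := Nat.pow_le_pow_left hp.two_le v
      have := hbern 1
      nlinarith
  have hwj : ‖w‖ ^ (i + 2) ≤ ‖((i + 2 : ℕ) : PadicAlgCl p)‖ * (p : ℝ)⁻¹ ^ (k + 1) := by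
    rw [PadicAlgCl.norm_natCast_eq_pow (by omega), ← hv, ← pow_add]
    calc ‖w‖ ^ (i + 2) ≤ ((p : ℝ)⁻¹ ^ k) ^ (i + 2) := by gcongr
      _ = (p : ℝ)⁻¹ ^ (k * (i + 2)) := by rw [pow_mul]
      _ ≤ _ := pow_le_pow_of_le_one hr0 hr1 (by omega)
  have hchoose : ‖(d.choose (i + 2) : PadicAlgCl p)‖ * ‖((i + 2 : ℕ) : PadicAlgCl p)‖
      ≤ ‖(d : PadicAlgCl p)‖ := by
    rcases d with _ | d
    · simp
    · have := congrArg (Nat.cast : ℕ → PadicAlgCl p) (Nat.add_one_mul_choose_eq d (i + 1))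
      rw [Nat.cast_mul, Nat.cast_mul] at this
      rw [← norm_mul, ← this, norm_mul]
      exact mul_le_of_le_one_right (norm_nonneg _) (PadicAlgCl.norm_natCast_le_one _)
  rw [norm_mul, norm_pow]
  calc _ ≤ ‖(d.choose (i + 2) : PadicAlgCl p)‖ *
        (‖((i + 2 : ℕ) : PadicAlgCl p)‖ * (p : ℝ)⁻¹ ^ (k + 1)) := by gcongr
    _ ≤ _ := by rw [← mul_assoc]; gcongr

/-- Powers of an element close to `1` are linear in the exponent `d`, with an error that is small
relative to `d`. -/
theorem PadicAlgCl.norm_one_add_pow_sub_le {k : ℕ} (hk : 1 ≤ k) (hk2 : p = 2 → 2 ≤ k)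
    {w : PadicAlgCl p} (hw : ‖w‖ ≤ (p : ℝ)⁻¹ ^ k) (d : ℕ) :
    ‖(1 + w) ^ d - 1 - d * w‖ ≤ ‖(d : PadicAlgCl p)‖ * (p : ℝ)⁻¹ ^ (k + 1) := by
  rcases d with _ | d
  · simp
  have : (1 + w) ^ (d + 1) - 1 - (d + 1 : ℕ) * w =
      ∑ j ∈ Finset.range d, ((d + 1).choose (j + 2) : PadicAlgCl p) * w ^ (j + 2) := by
    rw [add_comm 1 w, add_pow, Finset.sum_range_succ', Finset.sum_range_succ']
    simp [mul_comm]
  rw [this]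
  exact IsUltrametricDist.norm_sum_le_of_forall_le_of_nonneg (by positivity) fun j _ =>
    PadicAlgCl.norm_choose_mul_pow_le hk hk2 hw (d + 1) (by omega)

theorem PadicAlgCl.norm_pow_sub_one_le {k : ℕ} (hk : 1 ≤ k) (hk2 : p = 2 → 2 ≤ k)
    {v : PadicAlgCl p} (hv : ‖v - 1‖ ≤ (p : ℝ)⁻¹ ^ k) (d : ℕ) :
    ‖v ^ d - 1‖ ≤ ‖(d : PadicAlgCl p)‖ * (p : ℝ)⁻¹ ^ k := by
  have hp : p.Prime := Fact.out
  have hr1 : (p : ℝ)⁻¹ ≤ 1 := inv_le_one_of_one_le₀ (by exact_mod_cast hp.one_le)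
  have h := PadicAlgCl.norm_one_add_pow_sub_le hk hk2 hv d
  rw [add_sub_cancel] at h
  have : v ^ d - 1 = (v ^ d - 1 - d * (v - 1)) + d * (v - 1) := by ring
  rw [this]
  refine PadicAlgCl.norm_add_le_of_le (h.trans ?_) ?_
  · exact mul_le_mul_of_nonneg_left (pow_le_pow_of_le_one (by positivity) hr1 (by omega))
      (norm_nonneg _)
  · rw [norm_mul]; gcongr

theorem PadicAlgCl.norm_zpow_sub_one_le {k : ℕ} (hk : 1 ≤ k) (hk2 : p = 2 → 2 ≤ k)
    {v : PadicAlgCl p} (hv1 : ‖v‖ = 1) (hv : ‖v - 1‖ ≤ (p : ℝ)⁻¹ ^ k) (e : ℤ) :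
    ‖v ^ e - 1‖ ≤ ‖(e : PadicAlgCl p)‖ := by
  have hp : p.Prime := Fact.out
  have hr1 : (p : ℝ)⁻¹ ≤ 1 := inv_le_one_of_one_le₀ (by exact_mod_cast hp.one_le)
  have key (d : ℕ) : ‖v ^ d - 1‖ ≤ ‖(d : PadicAlgCl p)‖ :=
    (PadicAlgCl.norm_pow_sub_one_le hk hk2 hv d).trans
      (mul_le_of_le_one_right (norm_nonneg _) (pow_le_one₀ (by positivity) hr1))
  have hv0 : v ≠ 0 := norm_ne_zero_iff.1 (by rw [hv1]; exact one_ne_zero)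
  obtain ⟨d, rfl | rfl⟩ := e.eq_nat_or_neg
  · simpa using key d
  · have h : v ^ (-(d : ℤ)) - 1 = -((v ^ d)⁻¹ * (v ^ d - 1)) := by
      rw [zpow_neg, zpow_natCast]
      field_simp
      ring
    rw [h, norm_neg, norm_mul, norm_inv, norm_pow, hv1]
    simpa using key d

/-- The increments of `m ↦ ∑ i, A i * v i ^ m` are linear to first order when every `v i` is close
to `1`. -/
theorem PadicAlgCl.norm_expSum_sub_le {k : ℕ} (hk : 1 ≤ k) (hk2 : p = 2 → 2 ≤ k)
    {ι : Type*} [Fintype ι] {A v : ι → PadicAlgCl p} (hA : ∀ i, ‖A i‖ ≤ 1)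
    (hv : ∀ i, ‖v i - 1‖ ≤ (p : ℝ)⁻¹ ^ k) (m d : ℕ) :
    ‖∑ i, A i * v i ^ (m + d) - ∑ i, A i * v i ^ m - d * (∑ i, A i * v i - ∑ i, A i)‖
      ≤ ‖(d : PadicAlgCl p)‖ * (p : ℝ)⁻¹ ^ (k + 1) := by
  have hp : p.Prime := Fact.out
  have hr1 : (p : ℝ)⁻¹ ≤ 1 := inv_le_one_of_one_le₀ (by exact_mod_cast hp.one_le)
  rw [← Finset.sum_sub_distrib, ← Finset.sum_sub_distrib, Finset.mul_sum,
    ← Finset.sum_sub_distrib]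
  refine IsUltrametricDist.norm_sum_le_of_forall_le_of_nonneg (by positivity) fun i _ => ?_
  have hvm := PadicAlgCl.norm_pow_sub_one_le hk hk2 (hv i) m
  have hvm1 : ‖v i ^ m - 1‖ ≤ (p : ℝ)⁻¹ ^ k :=
    hvm.trans (mul_le_of_le_one_left (by positivity) (PadicAlgCl.norm_natCast_le_one m))
  have hvm2 : ‖v i ^ m‖ ≤ 1 := by
    rw [← sub_add_cancel (v i ^ m) 1]
    exact PadicAlgCl.norm_add_le_of_le (hvm1.trans (pow_le_one₀ (by positivity) hr1)) (by simp)
  have h := PadicAlgCl.norm_one_add_pow_sub_le hk hk2 (hv i) d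
  rw [add_sub_cancel] at h
  have : A i * v i ^ (m + d) - A i * v i ^ m - d * (A i * v i - A i) =
      A i * (v i ^ m * (v i ^ d - 1 - d * (v i - 1)) + d * ((v i ^ m - 1) * (v i - 1))) := by
    rw [pow_add]; ring
  rw [this, norm_mul]
  refine (mul_le_of_le_one_left (norm_nonneg _) (hA i)).trans
    (PadicAlgCl.norm_add_le_of_le ?_ ?_)
  · rw [norm_mul]
    exact (mul_le_of_le_one_left (norm_nonneg _) hvm2).trans h
  · rw [norm_mul, norm_mul]
    gcongr
    calc _ ≤ (p : ℝ)⁻¹ ^ k * (p : ℝ)⁻¹ ^ k := mul_le_mul hvm1 (hv i) (norm_nonneg _) (by positivity)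
      _ = (p : ℝ)⁻¹ ^ (k + k) := (pow_add _ _ _).symm
      _ ≤ _ := pow_le_pow_of_le_one (by positivity) hr1 (by omega)

/-! ### Approximation by roots of unity -/

theorem PadicAlgCl.exists_rootOfUnity_near {N : ℕ} (hN : 0 < N) (y : PadicAlgCl p) :
    ∃ ξ ∈ nthRootsFinset N (1 : PadicAlgCl p), ‖y - ξ‖ ^ N ≤ ‖y ^ N - 1‖ := by
  have : NeZero N := ⟨hN.ne'⟩
  obtain ⟨ζ, hζ⟩ := HasEnoughRootsOfUnity.exists_primitiveRoot (PadicAlgCl p) N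
  obtain ⟨ξ, hξ, hmin⟩ := (nthRootsFinset N (1 : PadicAlgCl p)).exists_min_image
    (fun ξ => ‖y - ξ‖) ⟨1, by simp [hN]⟩
  refine ⟨ξ, hξ, ?_⟩
  have h := congrArg (eval y) (X_pow_sub_one_eq_prod hN hζ)
  simp only [eval_sub, eval_pow, eval_X, eval_one, eval_prod, eval_C] at h
  rw [h, norm_prod]
  calc ‖y - ξ‖ ^ N = ∏ _η ∈ nthRootsFinset N (1 : PadicAlgCl p), ‖y - ξ‖ := by
        rw [Finset.prod_const, hζ.card_nthRootsFinset]
    _ ≤ _ := Finset.prod_le_prod (fun _ _ => norm_nonneg _) hmin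

/-- If exponents `n` converging `p`-adically to an integer `α` make `∑ i, A i * lam i ^ n` converge
to `0`, then `α` is a zero of this sum twisted by roots of unity. Indeed `lam i ^ (n - α)` is close
to an `N`-th root of unity, and there are only finitely many of those. -/
theorem PadicAlgCl.exists_twisted_zero {k : ℕ} (hk : 1 ≤ k) (hk2 : p = 2 → 2 ≤ k)
    {ι : Type*} [Fintype ι] {A lam : ι → PadicAlgCl p} (hA : ∀ i, ‖A i‖ ≤ 1)
    (hlam : ∀ i, ‖lam i‖ = 1) {N : ℕ} (hN : 0 < N)
    (hlamN : ∀ i, ‖lam i ^ N - 1‖ ≤ (p : ℝ)⁻¹ ^ k) (α : ℤ)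
    (happrox : ∀ s : ℕ, ∃ n : ℤ, (p : ℤ) ^ s ∣ n - α ∧ ‖∑ i, A i * lam i ^ n‖ ≤ (p : ℝ)⁻¹ ^ s) :
    ∃ ξ : ι → PadicAlgCl p, (∀ i, IsOfFinOrder (ξ i)) ∧ ∑ i, ξ i * A i * lam i ^ α = 0 := by
  classical
  have hp : p.Prime := Fact.out
  have hr1 : (p : ℝ)⁻¹ < 1 := inv_lt_one_of_one_lt₀ (by exact_mod_cast hp.one_lt)
  obtain ⟨ξ, hξ, hmin⟩ := (Fintype.piFinset fun _ : ι => nthRootsFinset N (1 : PadicAlgCl p))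
    |>.exists_min_image (fun ξ => ‖∑ i, ξ i * A i * lam i ^ α‖)
      ⟨fun _ => 1, by simp [Fintype.mem_piFinset, hN]⟩
  refine ⟨ξ, fun i => isOfFinOrder_iff_pow_eq_one.2 ⟨N, hN, ?_⟩, ?_⟩
  · exact (mem_nthRootsFinset hN _).1 (Fintype.mem_piFinset.1 hξ i)
  by_contra hne
  set ε := ‖∑ i, ξ i * A i * lam i ^ α‖
  have hε : 0 < ε := norm_pos_iff.2 hne
  obtain ⟨s, hs⟩ := exists_pow_lt_of_lt_one (lt_min hε (pow_pos hε N)) hr1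
  obtain ⟨n, hn, hsum⟩ := happrox s
  have hy (i : ι) : ‖(lam i ^ (n - α)) ^ N - 1‖ ≤ (p : ℝ)⁻¹ ^ s := by
    rw [← zpow_natCast, zpow_comm, zpow_natCast]
    exact (PadicAlgCl.norm_zpow_sub_one_le hk hk2 (by rw [norm_pow, hlam, one_pow]) (hlamN i)
      _).trans ((PadicAlgCl.norm_intCast_le_pow_iff _ s).2 hn)
  choose η hη hηy using fun i => PadicAlgCl.exists_rootOfUnity_near hN (lam i ^ (n - α))
  refine (hmin η (Fintype.mem_piFinset.2 hη)).not_gt ?_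
  have hsplit : ∑ i, η i * A i * lam i ^ α =
      ∑ i, A i * lam i ^ n + -∑ i, (lam i ^ (n - α) - η i) * (A i * lam i ^ α) := by
    rw [← sub_eq_add_neg, ← Finset.sum_sub_distrib]
    refine Finset.sum_congr rfl fun i _ => ?_
    have h0 : lam i ≠ 0 := norm_ne_zero_iff.1 (by rw [hlam]; exact one_ne_zero)
    have : lam i ^ n = lam i ^ (n - α) * lam i ^ α := by rw [← zpow_add₀ h0, sub_add_cancel]
    rw [this]; ring
  change ‖∑ i, η i * A i * lam i ^ α‖ < ε
  rw [hsplit]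
  refine (PadicAlgCl.isNonarchimedean p _ _).trans_lt
    (max_lt (hsum.trans_lt (hs.trans_le (min_le_left _ _))) ?_)
  rw [norm_neg]
  refine Finset.sum_induction _ (fun z : PadicAlgCl p => ‖z‖ < ε)
    (fun x y hx hy => (PadicAlgCl.isNonarchimedean p x y).trans_lt (max_lt hx hy))
    (by simpa using hε) fun i _ => ?_
  rw [norm_mul, norm_mul, norm_zpow, hlam, one_zpow, mul_one]
  refine (mul_le_of_le_one_right (norm_nonneg _) (hA i)).trans_lt (lt_of_pow_lt_pow_left₀ N hε.le ?_)
  exact ((hηy i).trans (hy i)).trans_lt (hs.trans_le (min_le_right _ _))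

end Norm

/-! ### The roots of the characteristic cubic and Binet's formula -/

section Binet

theorem charCubic_coeff (a b c : ℤ) : (charCubic a b c).coeff 0 = -c ∧
    (charCubic a b c).coeff 1 = -b ∧ (charCubic a b c).coeff 2 = -a ∧
    (charCubic a b c).coeff 3 = 1 := by
  refine ⟨?_, ?_, ?_, ?_⟩ <;> simp [charCubic, coeff_X, coeff_X_pow, -eq_intCast, coeff_C]

theorem charCubic_degree (a b c : ℤ) : (charCubic a b c).degree = 3 := by
  unfold charCubic
  compute_degree!

theorem charCubic_monic (a b c : ℤ) : (charCubic a b c).Monic := by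
  unfold charCubic
  monicity!

variable {L : Type*} [Field L] {a b c : ℤ} {lam : Fin 3 → L}

theorem charCubic_vieta
    (h : (charCubic a b c).map (Int.castRingHom L) = ∏ i, (X - C (lam i))) :
    (a : L) = lam 0 + lam 1 + lam 2 ∧
    (b : L) = -(lam 0 * lam 1 + lam 0 * lam 2 + lam 1 * lam 2) ∧
    (c : L) = lam 0 * lam 1 * lam 2 := by
  have hprod : ∏ i, (X - C (lam i)) = X ^ 3 - C (lam 0 + lam 1 + lam 2) * X ^ 2 +
      C (lam 0 * lam 1 + lam 0 * lam 2 + lam 1 * lam 2) * X - C (lam 0 * lam 1 * lam 2) := by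
    simp only [Fin.prod_univ_three, C_add, C_mul]
    ring
  have key (e₁ e₂ e₃ : L) (h : (charCubic a b c).map (Int.castRingHom L) =
      X ^ 3 - C e₁ * X ^ 2 + C e₂ * X - C e₃) : (a : L) = e₁ ∧ (b : L) = -e₂ ∧ (c : L) = e₃ := by
    obtain ⟨h0, h1, h2, -⟩ := charCubic_coeff a b c
    have hn (n : ℕ) := congrArg (fun f : L[X] => f.coeff n) h
    have k0 := hn 0
    have k1 := hn 1
    have k2 := hn 2
    simp only [coeff_map, h0, h1, h2] at k0 k1 k2
    simp [coeff_X, coeff_X_pow, coeff_C] at k0 k1 k2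
    exact ⟨k2, by rw [← k1, neg_neg], k0⟩
  exact key _ _ _ (h.trans hprod)

theorem charCubic_aeval_derivative (z : L) :
    aeval z (derivative (charCubic a b c)) = 3 * z ^ 2 - 2 * a * z - b := by
  have h2 : aeval z (2 : ℤ[X]) = 2 := map_ofNat _ 2
  have h3 : aeval z (3 : ℤ[X]) = 3 := map_ofNat _ 3
  simp [charCubic, h2, h3]
  ring

theorem coeffAt_eq (x₀ x₁ x₂ : ℤ) (z : L) : coeffAt a b c x₀ x₁ x₂ z =
    ((x₀ : L) * z ^ 2 + ((x₁ - x₀ * a : ℤ) : L) * z + ((x₂ - x₁ * a - x₀ * b : ℤ) : L)) /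
      (3 * z ^ 2 - 2 * a * z - b) := by
  rw [coeffAt, charCubic_aeval_derivative]

theorem charCubic_discr
    (h : (charCubic a b c).map (Int.castRingHom L) = ∏ i, (X - C (lam i))) :
    ((charCubic a b c).discr : L) =
      -∏ i, (3 * lam i ^ 2 - 2 * a * lam i - b) := by
  obtain ⟨ha, hb, hc⟩ := charCubic_vieta h
  obtain ⟨h0, h1, h2, h3⟩ := charCubic_coeff a b c
  rw [discr_of_degree_eq_three (charCubic_degree a b c), h0, h1, h2, h3]
  rw [Fin.prod_univ_three]
  push_cast
  rw [ha, hb, hc]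
  ring

theorem charCubic_root
    (h : (charCubic a b c).map (Int.castRingHom L) = ∏ i, (X - C (lam i))) (i : Fin 3) :
    lam i ^ 3 = a * lam i ^ 2 + b * lam i + c := by
  obtain ⟨ha, hb, hc⟩ := charCubic_vieta h
  rw [ha, hb, hc]
  fin_cases i <;> simp <;> ring

/-- Binet's formula for the terms of nonnegative index. -/
theorem recNat_eq_sum
    (h : (charCubic a b c).map (Int.castRingHom L) = ∏ i, (X - C (lam i)))
    (hd : ((charCubic a b c).discr : L) ≠ 0) (x₀ x₁ x₂ : ℤ) (n : ℕ) :
    (recNat a b c x₀ x₁ x₂ n : L) = ∑ i, coeffAt a b c x₀ x₁ x₂ (lam i) * lam i ^ n := by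
  rw [charCubic_discr h] at hd
  obtain ⟨ha, hb, hc⟩ := charCubic_vieta h
  have hd' : ∀ i, 3 * lam i ^ 2 - 2 * a * lam i - b ≠ 0 := fun i hi =>
    hd (by rw [Finset.prod_eq_zero (Finset.mem_univ i) hi, neg_zero])
  have e0 : 3 * lam 0 ^ 2 - 2 * a * lam 0 - b =
      (lam 0 - lam 1) * (lam 0 - lam 2) := by
    rw [ha, hb]; ring
  have e1 : 3 * lam 1 ^ 2 - 2 * a * lam 1 - b =
      -((lam 0 - lam 1) * (lam 1 - lam 2)) := by
    rw [ha, hb]; ring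
  have e2 : 3 * lam 2 ^ 2 - 2 * a * lam 2 - b =
      (lam 0 - lam 2) * (lam 1 - lam 2) := by
    rw [ha, hb]; ring
  have d0 := hd' 0
  have d2 := hd' 2
  rw [e0, mul_ne_zero_iff] at d0
  rw [e2, mul_ne_zero_iff] at d2
  have d01 := d0.1
  have d02 := d0.2
  have d12 := d2.2
  have initial (m : ℕ) (hm : m < 3) :
      (recNat a b c x₀ x₁ x₂ m : L) = ∑ i, coeffAt a b c x₀ x₁ x₂ (lam i) * lam i ^ m := by
    simp only [Fin.sum_univ_three, coeffAt_eq, e0, e1, e2]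
    push_cast
    rw [ha, hb]
    interval_cases m <;> simp only [recNat] <;> field_simp <;> ring
  induction n using Nat.strong_induction_on with
  | _ n ih =>
    rcases Nat.lt_or_ge n 3 with hn | hn
    · exact initial n hn
    · obtain ⟨m, rfl⟩ : ∃ m, n = m + 3 := ⟨n - 3, by omega⟩
      simp only [recNat]
      push_cast
      rw [ih _ (by omega), ih _ (by omega), ih _ (by omega), Finset.mul_sum, Finset.mul_sum,
        Finset.mul_sum, ← Finset.sum_add_distrib, ← Finset.sum_add_distrib]
      refine Finset.sum_congr rfl fun i _ => ?_
      rw [pow_add _ m 3, charCubic_root h i]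
      ring

end Binet

/-! ### Norms of the roots and of the coefficients, and the period -/

section Roots

variable {p : ℕ} [Fact p.Prime] {a b c : ℤ} {lam : Fin 3 → PadicAlgCl p}

theorem isIntegral_root
    (h : (charCubic a b c).map (Int.castRingHom (PadicAlgCl p)) = ∏ i, (X - C (lam i)))
    (i : Fin 3) : IsIntegral ℤ_[p] (lam i) := by
  have : IsIntegral ℤ (lam i) := by
    refine ⟨charCubic a b c, charCubic_monic a b c, ?_⟩
    have h' := congrArg (eval (lam i)) h
    rw [eval_map, eval_prod, Finset.prod_eq_zero (Finset.mem_univ i) (by simp)] at h'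
    exact h'
  exact this.tower_top

theorem norm_eq_one_of_prod {ι : Type*} [Fintype ι] {y : ι → PadicAlgCl p}
    (hy : ∀ i, ‖y i‖ ≤ 1) (hprod : ‖∏ i, y i‖ = 1) (i : ι) : ‖y i‖ = 1 := by
  classical
  refine (hy i).antisymm ?_
  rw [← hprod, norm_prod, ← Finset.mul_prod_erase _ _ (Finset.mem_univ i)]
  exact mul_le_of_le_one_right (norm_nonneg _)
    (Finset.prod_le_one (fun _ _ => norm_nonneg _) fun j _ => hy j)

theorem norm_intCast_eq_one {z : ℤ} (hz : ¬ (p : ℤ) ∣ z) : ‖(z : PadicAlgCl p)‖ = 1 := by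
  rw [PadicAlgCl.norm_intCast]
  exact (Padic.norm_int_le_one z).antisymm
    (not_lt.1 fun hlt => hz (Padic.norm_intCast_lt_one_iff.1 hlt))

theorem norm_root
    (h : (charCubic a b c).map (Int.castRingHom (PadicAlgCl p)) = ∏ i, (X - C (lam i)))
    (hc : ¬ (p : ℤ) ∣ c) (i : Fin 3) : ‖lam i‖ = 1 := by
  refine norm_eq_one_of_prod
    (fun j => PadicAlgCl.norm_le_one_of_isIntegral (isIntegral_root h j)) ?_ i
  rw [Fin.prod_univ_three, ← (charCubic_vieta h).2.2, norm_intCast_eq_one hc]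

theorem norm_coeffAt_le_one
    (h : (charCubic a b c).map (Int.castRingHom (PadicAlgCl p)) = ∏ i, (X - C (lam i)))
    (hdisc : ¬ (p : ℤ) ∣ (charCubic a b c).discr) (x₀ x₁ x₂ : ℤ) (i : Fin 3) :
    ‖coeffAt a b c x₀ x₁ x₂ (lam i)‖ ≤ 1 := by
  have hint (j : Fin 3) := isIntegral_root h j
  have hZ (z : ℤ) : IsIntegral ℤ_[p] (z : PadicAlgCl p) := by
    have : IsIntegral ℤ (z : PadicAlgCl p) := isIntegral_algebraMap (R := ℤ)
    exact this.tower_top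
  have hder (j : Fin 3) : ‖3 * lam j ^ 2 - 2 * a * lam j - b‖ ≤ 1 := by
    refine PadicAlgCl.norm_le_one_of_isIntegral ?_
    refine ((IsIntegral.mul ?_ ((hint j).pow 2)).sub (IsIntegral.mul (IsIntegral.mul ?_ (hZ a))
      (hint j))).sub (hZ b)
    · exact_mod_cast hZ 3
    · exact_mod_cast hZ 2
  have hder1 : ‖3 * lam i ^ 2 - 2 * a * lam i - b‖ = 1 := by
    refine norm_eq_one_of_prod hder ?_ i
    rw [← norm_neg, ← charCubic_discr h, norm_intCast_eq_one hdisc]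
  rw [coeffAt_eq, norm_div, hder1, div_one]
  exact PadicAlgCl.norm_le_one_of_isIntegral
    ((((hZ _).mul ((hint i).pow 2)).add ((hZ _).mul (hint i))).add (hZ _))

/-- The classes of the roots lie in a group of order `periodN`, so their powers to that exponent are
`1` modulo `p ^ k` in the ring of integers. An infinite group would make the exponent `0`. -/
theorem norm_root_pow_periodN_sub_one_le
    (h : (charCubic a b c).map (Int.castRingHom (PadicAlgCl p)) = ∏ i, (X - C (lam i)))
    (hc : ¬ (p : ℤ) ∣ c) (k : ℕ) (i : Fin 3) :
    ‖lam i ^ periodN p lam (p ^ k) - 1‖ ≤ (p : ℝ)⁻¹ ^ k := by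
  set K := IntermediateField.adjoin ℚ_[p] (Set.range lam)
  have : IsScalarTower ℤ_[p] K (PadicAlgCl p) := IsScalarTower.of_algebraMap_eq fun _ => rfl
  have hcoe : Function.Injective (algebraMap K (PadicAlgCl p)) := (algebraMap K _).injective
  have hz (j : Fin 3) : ∃ z : intRing p lam, ((z : K) : PadicAlgCl p) = lam j := by
    refine ⟨⟨⟨lam j, IntermediateField.subset_adjoin _ _ ⟨j, rfl⟩⟩, ?_⟩, rfl⟩
    have hint : IsIntegral ℤ_[p] (algebraMap K (PadicAlgCl p)
        ⟨lam j, IntermediateField.subset_adjoin _ _ ⟨j, rfl⟩⟩) := isIntegral_root h j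
    exact (isIntegral_algebraMap_iff hcoe).1 hint
  choose z hz using hz
  -- the roots are units of the ring of integers since their product `c` is a `p`-adic unit
  have hcu : IsUnit (c : ℤ_[p]) := by
    rw [PadicInt.isUnit_iff]
    refine (PadicInt.norm_le_one _).antisymm (not_lt.1 fun hlt => hc ?_)
    exact (PadicInt.norm_intCast_lt_one_iff).1 hlt
  have hprod : algebraMap ℤ_[p] (intRing p lam) c = z 0 * z 1 * z 2 := by
    apply Subtype.coe_injective
    apply Subtype.coe_injective
    simp [hz, (charCubic_vieta h).2.2]
  have hu : IsUnit (z i) := by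
    have := hcu.map (algebraMap ℤ_[p] (intRing p lam))
    rw [hprod, IsUnit.mul_iff, IsUnit.mul_iff] at this
    fin_cases i
    exacts [this.1.1, this.1.2, this.2]
  set I : Ideal (intRing p lam) := Ideal.span {((p ^ k : ℕ) : intRing p lam)}
  obtain ⟨u, hu⟩ := hu.map (Ideal.Quotient.mk I)
  have hmem : u ∈ Subgroup.closure {u : (intRing p lam ⧸ I)ˣ |
      ∃ (i : Fin 3) (z : intRing p lam), ((z : K) : PadicAlgCl p) = lam i ∧
        (u : intRing p lam ⧸ I) = Ideal.Quotient.mk _ z} :=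
    Subgroup.subset_closure ⟨i, z i, hz i, hu⟩
  have hpow : u ^ periodN p lam (p ^ k) = 1 :=
    congrArg Subtype.val (pow_card_eq_one' (x := (⟨u, hmem⟩ : Subgroup.closure _)))
  have hquot : Ideal.Quotient.mk I (z i ^ periodN p lam (p ^ k)) = Ideal.Quotient.mk I 1 := by
    rw [map_pow, ← hu, ← Units.val_pow_eq_pow_val, hpow, map_one, Units.val_one]
  obtain ⟨t, ht⟩ := Ideal.mem_span_singleton'.1 (Ideal.Quotient.eq.1 hquot)
  have ht' := congrArg (fun y : intRing p lam => ((y : K) : PadicAlgCl p)) ht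
  have heq : lam i ^ periodN p lam (p ^ k) - 1 = ((t : K) : PadicAlgCl p) * (p : PadicAlgCl p) ^ k := by
    rw [← hz i]
    simpa using ht'.symm
  have htint : IsIntegral ℤ_[p] ((t : K) : PadicAlgCl p) :=
    (isIntegral_algebraMap_iff (x := (t : K)) hcoe).2 t.2
  rw [heq, norm_mul, norm_pow, PadicAlgCl.norm_natCast_prime]
  exact mul_le_of_le_one_left (by positivity) (PadicAlgCl.norm_le_one_of_isIntegral htint)

end Roots

/-! ### Terms divisible by high powers of `p` -/

section Divisible

variable {p : ℕ} [Fact p.Prime]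

/-- A Hensel-type lifting: if `X (m + d) - X m` is `d * (X 1 - X 0)` up to an error of valuation
larger than `k + ν_p(d)`, with `X 1 - X 0` of valuation exactly `k`, then every residue of `X m`
can be killed one power of `p` at a time. -/
theorem exists_large_pow_dvd {k : ℕ} {X : ℕ → ℤ} (h0 : (p : ℤ) ^ k ∣ X 0)
    (hD : (p : ℤ) ^ k ∣ X 1 - X 0) (hD' : ¬ (p : ℤ) ^ (k + 1) ∣ X 1 - X 0)
    (hX : ∀ m j e : ℕ, (p : ℤ) ^ (j + (k + 1)) ∣
      X (m + p ^ j * e) - X m - p ^ j * e * (X 1 - X 0)) (j M : ℕ) :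
    ∃ m ≥ M, (p : ℤ) ^ (k + j) ∣ X m := by
  induction j with
  | zero =>
    refine ⟨M, le_rfl, ?_⟩
    have h := (pow_dvd_pow (p : ℤ) (show k ≤ 0 + (k + 1) by omega)).trans (hX 0 0 M)
    have : X M = (X (0 + p ^ 0 * M) - X 0 - p ^ 0 * M * (X 1 - X 0)) + X 0
        + p ^ 0 * M * (X 1 - X 0) := by
      rw [pow_zero, one_mul, zero_add]
      ring
    rw [this, add_zero]
    exact dvd_add (dvd_add h h0) (hD.mul_left _)
  | succ j ih =>
    obtain ⟨m, hm, α, hα⟩ := ih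
    obtain ⟨β, hβ⟩ := hD
    have hβp : ((β : ℤ) : ZMod p) ≠ 0 := fun h => hD' <| by
      obtain ⟨γ, hγ⟩ := (ZMod.intCast_zmod_eq_zero_iff_dvd β p).1 h
      exact ⟨γ, by rw [hβ, hγ]; ring⟩
    set e : ℕ := (-(α : ZMod p) * (β : ZMod p)⁻¹).val with he
    have hlin : (p : ℤ) ∣ α + e * β := by
      rw [← ZMod.intCast_zmod_eq_zero_iff_dvd]
      push_cast
      rw [he, ZMod.natCast_zmod_val, mul_assoc, inv_mul_cancel₀ hβp]
      ring
    obtain ⟨γ, hγ⟩ := hlin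
    refine ⟨m + p ^ j * e, by omega, ?_⟩
    have : X (m + p ^ j * e) = (X (m + p ^ j * e) - X m - p ^ j * e * (X 1 - X 0)) +
        (p : ℤ) ^ (j + (k + 1)) * γ := by
      rw [hα, hβ]
      linear_combination (p : ℤ) ^ (j + k) * hγ
    rw [this, show k + (j + 1) = j + (k + 1) by omega]
    exact dvd_add (hX m j e) (dvd_mul_right _ _)

/-- The indices `n = ℓ + N * m` with `p ^ (k + 1) ∣ x n` are congruent to the approximate zero modulo
`p`. -/
theorem henselApprox_eq_of_dvd {k N ℓ m : ℕ} {x : ℕ → ℤ} (h0 : (p : ℤ) ^ k ∣ x ℓ)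
    (hD : (p : ℤ) ^ k ∣ x (ℓ + N) - x ℓ) (hD' : ¬ (p : ℤ) ^ (k + 1) ∣ x (ℓ + N) - x ℓ)
    (hX : (p : ℤ) ^ (k + 1) ∣ x (ℓ + N * m) - x ℓ - m * (x (ℓ + N) - x ℓ))
    (hm : (p : ℤ) ^ (k + 1) ∣ x (ℓ + N * m)) :
    henselApprox p x (p ^ k) N ℓ = ((ℓ + N * m : ℕ) : ZMod p) := by
  have hp : (p : ℤ) ^ k ≠ 0 := pow_ne_zero _ (by exact_mod_cast (Fact.out : p.Prime).ne_zero)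
  unfold henselApprox
  obtain ⟨α, hα⟩ := h0
  obtain ⟨β, hβ⟩ := hD
  have hβp : ((β : ℤ) : ZMod p) ≠ 0 := fun h => hD' <| by
    obtain ⟨γ, hγ⟩ := (ZMod.intCast_zmod_eq_zero_iff_dvd β p).1 h
    exact ⟨γ, by rw [hβ, hγ]; ring⟩
  have hlin : (p : ℤ) ^ k * p ∣ (p : ℤ) ^ k * (α + m * β) := by
    rw [← pow_succ]
    have := dvd_sub hm hX
    rw [hβ, hα] at this
    rwa [show (p : ℤ) ^ k * (α + m * β) =
      x (ℓ + N * m) - (x (ℓ + N * m) - p ^ k * α - m * (p ^ k * β)) by ring]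
  have hlin' := (ZMod.intCast_zmod_eq_zero_iff_dvd _ p).2 ((mul_dvd_mul_iff_left hp).1 hlin)
  push_cast at hlin'
  have hαβ : (α : ZMod p) * (β : ZMod p)⁻¹ = -m := by
    rw [eq_neg_of_add_eq_zero_left hlin', neg_mul, mul_assoc, mul_inv_cancel₀ hβp, mul_one]
  rw [Nat.cast_pow, hβ, hα, Int.mul_ediv_cancel_left _ hp, Int.mul_ediv_cancel_left _ hp, hαβ]
  push_cast
  ring

end Divisible

/-! ### Consequences of the conjectured shape of the valuations -/

section Conjecture

variable {p : ℕ} [Fact p.Prime]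

theorem le_nuP_intCast_iff (z : ℤ) (n : ℕ) :
    ((n : ℤ) : WithTop ℤ) ≤ nuP p (z : ℚ) ↔ (p : ℤ) ^ n ∣ z := by
  rcases eq_or_ne z 0 with rfl | hz
  · simp [nuP]
  · have hz' : (((z : ℤ) : ℚ) : ℚ_[p]) ≠ 0 := by exact_mod_cast hz
    rw [nuP, Padic.addValuation.apply hz', WithTop.coe_le_coe, Rat.cast_intCast,
      Padic.valuation_intCast, padicValInt_dvd_iff, Nat.cast_le]
    simp [hz]

/-- If the valuation conjecture holds and terms divisible by arbitrarily high powers of `p` occur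
at arbitrarily large exponents `f m`, then such exponents converge `p`-adically to an integer:
only the alternative (L) can hold on a residue class containing infinitely many of them. -/
theorem ValuationConjecture.exists_limit {x : ℤ → ℚ} (h : ValuationConjecture p x) {X : ℕ → ℤ}
    {f : ℕ → ℕ} (hf : ∀ m, m ≤ f m) (hx : ∀ m, x (f m) = X m)
    (hX : ∀ T M : ℕ, ∃ m ≥ M, (p : ℤ) ^ T ∣ X m) :
    ∃ α : ℤ, ∀ s : ℕ, ∃ m, (p : ℤ) ^ s ∣ (f m : ℤ) - α ∧ (p : ℤ) ^ s ∣ X m := by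
  obtain ⟨Q, hQ, hclass⟩ := h
  -- a single residue class contains such exponents for all `T`, as there are finitely many classes
  obtain ⟨i, hiQ, hi⟩ : ∃ i < Q, ∀ T M : ℕ, ∃ m ≥ M, (p : ℤ) ^ T ∣ X m ∧ f m % Q = i := by
    by_contra! hcon
    choose! T M hTM using hcon
    obtain ⟨m, hm, hdvd⟩ := hX ((Finset.range Q).sup T) ((Finset.range Q).sup M)
    have hr : f m % Q ∈ Finset.range Q := Finset.mem_range.2 (Nat.mod_lt _ hQ)
    exact hTM (f m % Q) (Finset.mem_range.1 hr) m ((Finset.le_sup hr).trans hm)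
      ((pow_dvd_pow _ (Finset.le_sup hr)).trans hdvd) rfl
  have avoid {P : ℤ → Prop} (hfin : {n : ℤ | n ≡ i [ZMOD Q] ∧ ¬ P n}.Finite) (T : ℕ) :
      ∃ m, (p : ℤ) ^ T ∣ X m ∧ P (f m) := by
    obtain ⟨B, hB⟩ := hfin.bddAbove
    obtain ⟨m, hm, hdvd, hmod⟩ := hi T (B.toNat + 1)
    refine ⟨m, hdvd, by_contra fun hP => ?_⟩
    have hmem : ((f m : ℕ) : ℤ) ≡ i [ZMOD Q] := by
      rw [Int.natCast_modEq_iff, ← hmod]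
      exact (Nat.mod_modEq _ _).symm
    have := hB ⟨hmem, hP⟩
    have := hf m
    omega
  rcases hclass i hiQ with ⟨κ, hfin⟩ | ⟨α, κ, μ, hμ, -, hfin⟩
  · exfalso
    obtain ⟨m, hdvd, hval⟩ := avoid hfin (κ + 1)
    rw [hx m] at hval
    have := (le_nuP_intCast_iff _ _).2 hdvd
    rw [hval, WithTop.coe_le_coe] at this
    omega
  · refine ⟨α, fun s => ?_⟩
    obtain ⟨m, hdvd, hval⟩ := avoid hfin ((κ + μ * s).toNat + s)
    refine ⟨m, ?_, (pow_dvd_pow _ (by omega)).trans hdvd⟩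
    rw [hx m] at hval
    have hle := (le_nuP_intCast_iff _ _).2 hdvd
    rw [hval] at hle
    rw [← le_nuP_intCast_iff]
    generalize nuP p (((f m : ℤ) - α : ℤ) : ℚ) = w at hle ⊢
    induction w with
    | top => exact le_top
    | coe w =>
      rw [← WithTop.coe_nsmul, ← WithTop.coe_add, WithTop.coe_le_coe, nsmul_eq_mul] at hle
      rw [WithTop.coe_le_coe]
      by_contra! hlt
      have hμ' : (0 : ℤ) < μ := by exact_mod_cast hμ
      have h1 : (μ : ℤ) * w < μ * s := mul_lt_mul_of_pos_left hlt hμ'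
      have h2 : κ + μ * s ≤ (κ + μ * s).toNat := Int.self_le_toNat _
      push_cast at hle
      omega

end Conjecture

/-! ### The failure of the conjecture -/

section Failure

variable {p : ℕ} [Fact p.Prime] {a b c : ℤ} {lam : Fin 3 → PadicAlgCl p}

/-- The failure criterion for the modulus `p ^ k`. The exponent `N` need only satisfy
`lam i ^ N ≡ 1` modulo `p ^ k`, with `k ≥ 1`, and `k ≥ 2` when `p = 2`. -/
theorem not_valuationConjecture
    (hlam : (charCubic a b c).map (Int.castRingHom (PadicAlgCl p)) = ∏ i, (X - C (lam i)))
    (hdisc : ¬ (p : ℤ) ∣ (charCubic a b c).discr) (hc : ¬ (p : ℤ) ∣ c) (x₀ x₁ x₂ : ℤ)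
    {k : ℕ} (hk : 1 ≤ k) (hk2 : p = 2 → 2 ≤ k) {N ℓ : ℕ} (hN : 0 < N)
    (hlamN : ∀ i, ‖lam i ^ N - 1‖ ≤ (p : ℝ)⁻¹ ^ k)
    (hℓ : (p : ℤ) ^ k ∣ recNat a b c x₀ x₁ x₂ ℓ)
    (hD : ¬ (p : ℤ) ^ (k + 1) ∣ recNat a b c x₀ x₁ x₂ (ℓ + N) - recNat a b c x₀ x₁ x₂ ℓ)
    (hZ : ∀ r ∈ twistedIntegralZeros a b c x₀ x₁ x₂ lam,
      henselApprox p (recNat a b c x₀ x₁ x₂) (p ^ k) N ℓ ≠ (r : ZMod p)) :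
    ¬ ValuationConjecture p (recInt a b c x₀ x₁ x₂) := by
  intro hconj
  have hdisc0 : ((charCubic a b c).discr : PadicAlgCl p) ≠ 0 := fun h =>
    hdisc (by rw [Int.cast_eq_zero.1 h]; exact dvd_zero _)
  have hbinet := recNat_eq_sum hlam hdisc0 x₀ x₁ x₂
  set x := recNat a b c x₀ x₁ x₂
  set A : Fin 3 → PadicAlgCl p := fun i => coeffAt a b c x₀ x₁ x₂ (lam i)
  have hA (i) : ‖A i‖ ≤ 1 := norm_coeffAt_le_one hlam hdisc x₀ x₁ x₂ i
  have hlam1 (i) : ‖lam i‖ = 1 := norm_root hlam hc i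
  have hA' (i) : ‖A i * lam i ^ ℓ‖ ≤ 1 := by simpa [hlam1] using hA i
  have hsum (m : ℕ) : (x (ℓ + N * m) : PadicAlgCl p) = ∑ i, A i * lam i ^ ℓ * (lam i ^ N) ^ m := by
    rw [hbinet]
    exact Finset.sum_congr rfl fun i _ => by rw [pow_add, pow_mul, mul_assoc]
  have hlin (m j e : ℕ) : (p : ℤ) ^ (j + (k + 1)) ∣
      x (ℓ + N * (m + p ^ j * e)) - x (ℓ + N * m) - p ^ j * e * (x (ℓ + N * 1) - x (ℓ + N * 0)) := by
    rw [← PadicAlgCl.norm_intCast_le_pow_iff]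
    push_cast
    rw [hsum, hsum, hsum, hsum]
    have h := PadicAlgCl.norm_expSum_sub_le hk hk2 hA' hlamN m (p ^ j * e)
    push_cast at h
    simp only [pow_one, pow_zero, mul_one]
    refine h.trans ?_
    rw [norm_mul, norm_pow, PadicAlgCl.norm_natCast_prime, pow_add _ j (k + 1)]
    gcongr
    exact mul_le_of_le_one_right (by positivity) (PadicAlgCl.norm_natCast_le_one e)
  have hDk : (p : ℤ) ^ k ∣ x (ℓ + N * 1) - x (ℓ + N * 0) := by
    rw [← PadicAlgCl.norm_intCast_le_pow_iff]
    push_cast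
    rw [hsum, hsum, ← Finset.sum_sub_distrib]
    refine IsUltrametricDist.norm_sum_le_of_forall_le_of_nonneg (by positivity) fun i _ => ?_
    rw [pow_one, pow_zero, ← mul_sub, norm_mul]
    exact (mul_le_of_le_one_left (norm_nonneg _) (hA' i)).trans (hlamN i)
  have hlarge (T M : ℕ) : ∃ m ≥ M, (p : ℤ) ^ T ∣ x (ℓ + N * m) := by
    obtain ⟨m, hm, hdvd⟩ := exists_large_pow_dvd (X := fun m => x (ℓ + N * m))
      (by simpa using hℓ) hDk (by simpa using hD) hlin T M
    exact ⟨m, hm, (pow_dvd_pow _ (Nat.le_add_left T k)).trans hdvd⟩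
  obtain ⟨α, hα⟩ := hconj.exists_limit (X := fun m => x (ℓ + N * m)) (f := fun m => ℓ + N * m)
    (fun m => (Nat.le_mul_of_pos_left m hN).trans (Nat.le_add_left _ _)) (fun m => rfl) hlarge
  have hαZ : α ∈ twistedIntegralZeros a b c x₀ x₁ x₂ lam := by
    refine PadicAlgCl.exists_twisted_zero hk hk2 hA hlam1 hN hlamN α fun s => ?_
    obtain ⟨m, hm, hxm⟩ := hα s
    refine ⟨_, hm, ?_⟩
    simp only [zpow_natCast]
    rw [← hbinet]
    exact (PadicAlgCl.norm_intCast_le_pow_iff _ s).2 hxm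
  refine hZ α hαZ ?_
  obtain ⟨m, hm, hxm⟩ := hα (k + 1)
  rw [henselApprox_eq_of_dvd hℓ (by simpa using hDk) hD (by simpa using hlin 0 0 m) hxm]
  have := (ZMod.intCast_zmod_eq_zero_iff_dvd _ p).2 ((dvd_pow_self (p : ℤ) (by omega)).trans hm)
  rw [Int.cast_sub, sub_eq_zero] at this
  exact_mod_cast this

end Failure

theorem theorem1p2 (p : ℕ) [Fact p.Prime] (a b c x₀ x₁ x₂ : ℤ)
    (hirr : Irreducible ((charCubic a b c).map (Int.castRingHom ℚ)))
    (lam : Fin 3 → AlgebraicClosure ℚ_[p])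
    (hlam : (charCubic a b c).map (Int.castRingHom (AlgebraicClosure ℚ_[p])) =
      ∏ i, (X - C (lam i)))
    (hdisc : ¬ (p : ℤ) ∣ (charCubic a b c).discr)
    (hc : ¬ (p : ℤ) ∣ c) :
    (p = 2 → ∀ ℓ : ℕ, ℓ < periodN p lam (p ^ 2) →
      (p : ℤ) ^ 2 ∣ recNat a b c x₀ x₁ x₂ ℓ →
      ¬ recNat a b c x₀ x₁ x₂ (ℓ + periodN p lam (p ^ 2)) - recNat a b c x₀ x₁ x₂ ℓ
        ≡ 0 [ZMOD (p : ℤ) ^ 3] →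
      (∀ r ∈ twistedIntegralZeros a b c x₀ x₁ x₂ lam,
        henselApprox p (recNat a b c x₀ x₁ x₂) (p ^ 2) (periodN p lam (p ^ 2)) ℓ
          ≠ (r : ZMod p)) →
      ¬ ValuationConjecture p (recInt a b c x₀ x₁ x₂)) ∧
    (p ≠ 2 → ∀ ℓ : ℕ, ℓ < periodN p lam p →
      (p : ℤ) ∣ recNat a b c x₀ x₁ x₂ ℓ →
      ¬ recNat a b c x₀ x₁ x₂ (ℓ + periodN p lam p) - recNat a b c x₀ x₁ x₂ ℓ
        ≡ 0 [ZMOD (p : ℤ) ^ 2] →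
      (∀ r ∈ twistedIntegralZeros a b c x₀ x₁ x₂ lam,
        henselApprox p (recNat a b c x₀ x₁ x₂) p (periodN p lam p) ℓ ≠ (r : ZMod p)) →
      ¬ ValuationConjecture p (recInt a b c x₀ x₁ x₂)) := by

  -- the condition `ℓ < N` excludes the junk value `N = 0` of `Nat.card`
  have hnot (k ℓ : ℕ) (hk : 1 ≤ k) (hk2 : p = 2 → 2 ≤ k) (hℓ : ℓ < periodN p lam (p ^ k)) :=
    not_valuationConjecture hlam hdisc hc x₀ x₁ x₂ hk hk2 (ℓ := ℓ) (Nat.zero_lt_of_lt hℓ)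
      (norm_root_pow_periodN_sub_one_le hlam hc k)
  constructor
  · intro _ ℓ hℓ hdvd hD hZ
    exact hnot 2 ℓ one_le_two (fun _ => le_rfl) hℓ hdvd
      (fun h => hD (Int.modEq_zero_iff_dvd.2 h)) hZ
  · intro hp ℓ hℓ hdvd hD hZ
    have h := hnot 1 ℓ le_rfl (fun h => absurd h hp)
    rw [pow_one] at h
    exact h hℓ (by rwa [pow_one]) (fun h => hD (Int.modEq_zero_iff_dvd.2 h)) hZ
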